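/- Let $\mathbb D=\{z\in\mathbb C:|z|<1\}$, let $\beta<1$ be a real number, and let $\lambda\in\mathbb D$ and $z_0\in\mathbb D\setminus\{0\}$. Let $\mathcal A$ be the class of analytic functions $f$ in $\mathbb D$ with $f(0)=0$ and $f'(0)=1$. Put $$\mathcal R(\lambda)=\{f\in\mathcal A:\ \operatorname{Re}f'(z)>\beta\text{ for all }z\in\mathbb D,\ f''(0)=2(1-\beta)\lambda\},\qquad V_{\mathcal R}(z_0,\lambda)=\{f(z_0):f\in\mathcal R(\lambda)\},$$ and, for $\theta\in(-\pi,\pi]$ and $z\in\mathbb D$, $$H_{e^{i\theta},\lambda}(z)=z+2(1-\beta)\int_0^{z}\frac{(e^{i\theta}\zeta+\lambda)\zeta}{1+\overline{\lambda}e^{i\theta}\zeta-(e^{i\theta}\zeta+\lambda)\zeta}\,d\zeta .$$ Then the boundary $\partial V_{\mathcal R}(z_0,\lambda)$ is the Jordan curve $(-\pi,\pi]\ni\theta\mapsto H_{e^{i\theta},\lambda}(z_0)$; that is, this map is a simple closed curve and its image is exactly $\partial V_{\mathcal R}(z_0,\lambda)$. Moreover, for each $\theta\in(-\pi,\pi]$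 we have $H_{e^{i\theta},\lambda}\in\mathcal R(\lambda)$, and if $f\in\mathcal R(\lambda)$ satisfies $f(z_0)=H_{e^{i\theta},\lambda}(z_0)$, then $f(z)=H_{e^{i\theta},\lambda}(z)$ for all $z\in\mathbb D$. -/

import Mathlib

open Set Metric

namespace RegionOfVariability

/-- The class `𝒜`: functions analytic in the open unit disk `𝔻` with `f 0 = 0` and `f' 0 = 1`.
A function on `𝔻` is represented by a map `ℂ → ℂ` whose values off `𝔻` play no role. -/
def classA : Set (ℂ → ℂ) :=
  {f | DifferentiableOn ℂ f (ball 0 1) ∧ f 0 = 0 ∧ deriv f 0 = 1}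

/-- The class `ℛ_β`: functions in `𝒜` with `Re f' > β` in `𝔻`. -/
def classRBeta (β : ℝ) : Set (ℂ → ℂ) :=
  {f | f ∈ classA ∧ ∀ z ∈ ball (0 : ℂ) 1, β < (deriv f z).re}

/-- The class `ℛ(lam)`: functions in `ℛ_β` with `f'' 0 = 2 (1 - β) lam`. -/
def classR (β : ℝ) (lam : ℂ) : Set (ℂ → ℂ) :=
  {f | f ∈ classRBeta β ∧ deriv (deriv f) 0 = 2 * (1 - (β : ℂ)) * lam}

/-- The region of variability `V_ℛ(z₀, lam) = {f z₀ : f ∈ ℛ(lam)}`. -/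
def variabilityRegion (β : ℝ) (z₀ lam : ℂ) : Set ℂ :=
  {w | ∃ f ∈ classR β lam, f z₀ = w}

/-- The complex line integral `∫₀ᶻ g(ζ) dζ` along the segment `ζ = t z`, `0 ≤ t ≤ 1`. It is used
only for `g` analytic in `𝔻` and `z ∈ 𝔻`, where every path in `𝔻` gives the same value. -/
noncomputable def integralFromZero (g : ℂ → ℂ) (z : ℂ) : ℂ :=
  ∫ t in (0 : ℝ)..1, g ((t : ℂ) * z) * z

/-- `H_{a,lam}(z) = z + 2 (1 - β) ∫₀ᶻ (a ζ + lam) ζ / (1 + conj lam a ζ - (a ζ + lam) ζ) dζ`. -/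
noncomputable def extremalH (β : ℝ) (a lam z : ℂ) : ℂ :=
  z + 2 * (1 - (β : ℂ)) * integralFromZero
    (fun ζ => (a * ζ + lam) * ζ /
      (1 + (starRingEnd ℂ) lam * a * ζ - (a * ζ + lam) * ζ)) z

/-- `θ ↦ γ θ`, `θ ∈ (-π, π]`, is a Jordan curve (a simple closed curve) in the plane:
`γ` is continuous on `[-π, π]`, it closes up, and it is injective on `(-π, π]`. -/
def IsJordanCurve (γ : ℝ → ℂ) : Prop :=
  ContinuousOn γ (Icc (-Real.pi) Real.pi) ∧ γ (-Real.pi) = γ Real.pi ∧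
    InjOn γ (Ioc (-Real.pi) Real.pi)

end RegionOfVariability

namespace RegionOfVariability

open Complex Filter Topology ComplexConjugate

/-! Two applications of the Schwarz lemma write every derivative `f'` in the class as `1 + 2(1-β) *
integrand lam (h z) z` with `|h| ≤ 1`; the extremal functions are those with `h` a unimodular
constant `a`. Subtracting two such formulas gives (`extremalH_sub_eq`) `f z - H_a z = c a ∫₀ᶻ ζ²
q(ζ) / den(ζ)² dζ` with `c > 0`, where `Re q < 0` unless `h` is identically `a`. The function `G(z)
= ∫₀ᶻ ζ² / den(ζ)² dζ` satisfies `Re (z G'/G) > 0`, so a Miller–Mocanu argument transfers `Re q < 0`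
to the quotient of the two integrals. Thus the region lies strictly on one side of a line through
`H_a z₀` with normal `a G(z₀)`, except for `H_a z₀` itself, which only `H_a` attains
(`eqOn_or_re_sub_extremalH_div_neg`). This yields uniqueness and injectivity of the curve. The
normals take every direction (`exists_supportNormal_eq`), so by separation these half-planes cut out
the convex hull of the curve, and the region is that hull. Compactness of the circle makes every
point of it off the curve interior. -/

/-! ### Radial means and their differential equation -/

theorem ofReal_mul_mem_ball {t : ℝ} {z : ℂ} (ht : t ∈ Icc (0 : ℝ) 1)
    (hz : z ∈ ball (0 : ℂ) 1) : (t : ℂ) * z ∈ ball (0 : ℂ) 1 := by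
  rw [mem_ball_zero_iff] at *
  rw [norm_mul, norm_real, Real.norm_of_nonneg ht.1]
  exact (mul_le_of_le_one_left (norm_nonneg _) ht.2).trans_lt hz

/-- The weighted mean `∫₀¹ tⁿ φ (t z) dt` of `φ` along the radius ending at `z`. -/
noncomputable def radialMean (n : ℕ) (φ : ℂ → ℂ) (z : ℂ) : ℂ :=
  ∫ t in (0 : ℝ)..1, (t : ℂ) ^ n * φ ((t : ℂ) * z)

theorem continuousOn_radial {φ : ℂ → ℂ} (hφ : ContinuousOn φ (ball 0 1)) (n : ℕ) {z : ℂ}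
    (hz : z ∈ ball (0 : ℂ) 1) :
    ContinuousOn (fun t : ℝ => (t : ℂ) ^ n * φ ((t : ℂ) * z)) (Icc 0 1) := by
  refine ContinuousOn.mul (by fun_prop) (hφ.comp (by fun_prop) ?_)
  exact fun t ht => ofReal_mul_mem_ball ht hz

theorem intervalIntegrable_radial {φ : ℂ → ℂ} (hφ : ContinuousOn φ (ball 0 1)) (n : ℕ) {z : ℂ}
    (hz : z ∈ ball (0 : ℂ) 1) :
    IntervalIntegrable (fun t : ℝ => (t : ℂ) ^ n * φ ((t : ℂ) * z)) MeasureTheory.volume 0 1 :=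
  ContinuousOn.intervalIntegrable (by
    rw [uIcc_of_le zero_le_one]; exact continuousOn_radial hφ n hz)

theorem hasDerivAt_radialMean {φ : ℂ → ℂ} (hφ : DifferentiableOn ℂ φ (ball 0 1)) (n : ℕ) {z : ℂ}
    (hz : z ∈ ball (0 : ℂ) 1) :
    HasDerivAt (radialMean n φ) (radialMean (n + 1) (deriv φ) z) z := by
  have hφ' : ContinuousOn (deriv φ) (ball 0 1) := (hφ.deriv isOpen_ball).continuousOn
  obtain ⟨r, hzr, hr⟩ := exists_between (mem_ball_zero_iff.1 hz)
  have hsub : closedBall (0 : ℂ) r ⊆ ball 0 1 := closedBall_subset_ball hr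
  obtain ⟨C, hC⟩ := (isCompact_closedBall (0 : ℂ) r).exists_bound_of_continuousOn
    (hφ'.mono hsub)
  have hs : ball (0 : ℂ) r ∈ 𝓝 z := isOpen_ball.mem_nhds (mem_ball_zero_iff.2 hzr)
  refine (intervalIntegral.hasDerivAt_integral_of_dominated_loc_of_deriv_le
    (F := fun w (t : ℝ) => (t : ℂ) ^ n * φ ((t : ℂ) * w))
    (F' := fun w (t : ℝ) => (t : ℂ) ^ (n + 1) * deriv φ ((t : ℂ) * w)) (bound := fun _ => C)
    hs ?_ (intervalIntegrable_radial hφ.continuousOn n hz)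
    (intervalIntegrable_radial hφ' (n + 1) hz).aestronglyMeasurable_restrict_uIoc ?_
    intervalIntegrable_const ?_).2
  · filter_upwards [hs] with w hw
    exact (intervalIntegrable_radial hφ.continuousOn n
      (hsub (ball_subset_closedBall hw))).aestronglyMeasurable_restrict_uIoc
  · refine .of_forall fun t ht w hw => ?_
    rw [uIoc_of_le zero_le_one] at ht
    have h1 : ‖(t : ℂ) ^ (n + 1)‖ ≤ 1 := by
      rw [norm_pow, norm_real, Real.norm_of_nonneg ht.1.le]
      exact pow_le_one₀ ht.1.le ht.2
    have h2 : ‖deriv φ ((t : ℂ) * w)‖ ≤ C := by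
      apply hC
      rw [mem_closedBall_zero_iff, norm_mul, norm_real, Real.norm_of_nonneg ht.1.le]
      exact (mul_le_of_le_one_left (norm_nonneg _) ht.2).trans (mem_ball_zero_iff.1 hw).le
    rw [norm_mul]
    exact (mul_le_of_le_one_left (norm_nonneg _) h1).trans h2
  · refine .of_forall fun t ht w hw => ?_
    rw [uIoc_of_le zero_le_one] at ht
    have hw1 := hsub (ball_subset_closedBall hw)
    have h1 := (hφ.differentiableAt (isOpen_ball.mem_nhds
      (ofReal_mul_mem_ball ⟨ht.1.le, ht.2⟩ hw1))).hasDerivAt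
    have h2 : HasDerivAt (fun w : ℂ => (t : ℂ) * w) (t : ℂ) w := by
      simpa using (hasDerivAt_id w).const_mul (t : ℂ)
    have h3 := (h1.comp w h2).const_mul ((t : ℂ) ^ n)
    refine h3.congr_deriv ?_
    ring

theorem differentiableOn_radialMean {φ : ℂ → ℂ} (hφ : DifferentiableOn ℂ φ (ball 0 1)) (n : ℕ) :
    DifferentiableOn ℂ (radialMean n φ) (ball 0 1) :=
  fun _ hz => (hasDerivAt_radialMean hφ n hz).differentiableAt.differentiableWithinAt

/-- The first order differential equation satisfied by a radial mean. -/
theorem radialMean_add_mul_deriv {φ : ℂ → ℂ} (hφ : DifferentiableOn ℂ φ (ball 0 1)) (n : ℕ)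
    {z : ℂ} (hz : z ∈ ball (0 : ℂ) 1) :
    (n + 1) * radialMean n φ z + z * deriv (radialMean n φ) z = φ z := by
  have hφ' : ContinuousOn (deriv φ) (ball 0 1) := (hφ.deriv isOpen_ball).continuousOn
  have i1 := intervalIntegrable_radial hφ.continuousOn n hz
  have i2 := intervalIntegrable_radial hφ' (n + 1) hz
  -- Integrate the `t`-derivative of `t^(n+1) φ(tz)`; the boundary term at `0` vanishes because the
  -- exponent is positive.
  have key := intervalIntegral.integral_eq_sub_of_hasDerivAt (a := 0) (b := 1)
    (f := fun t : ℝ => (t : ℂ) ^ (n + 1) * φ ((t : ℂ) * z))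
    (f' := fun t : ℝ => ((n : ℂ) + 1) * ((t : ℂ) ^ n * φ ((t : ℂ) * z)) +
      z * ((t : ℂ) ^ (n + 1) * deriv φ ((t : ℂ) * z))) ?_ ((i1.const_mul _).add (i2.const_mul _))
  · rw [intervalIntegral.integral_add (i1.const_mul _) (i2.const_mul _),
      intervalIntegral.integral_const_mul, intervalIntegral.integral_const_mul] at key
    rw [(hasDerivAt_radialMean hφ n hz).deriv]
    simpa [radialMean] using key
  · intro t ht
    rw [uIcc_of_le zero_le_one] at ht
    have h1 := (hφ.differentiableAt (isOpen_ball.mem_nhds (ofReal_mul_mem_ball ht hz))).hasDerivAt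
    have h2 : HasDerivAt (fun t : ℝ => (t : ℂ) * z) z t := by
      simpa using (ofRealCLM.hasDerivAt (x := t)).mul_const z
    have h3 : HasDerivAt (fun t : ℝ => φ ((t : ℂ) * z)) (deriv φ ((t : ℂ) * z) * z) t :=
      h1.comp t h2
    have h4 : HasDerivAt (fun t : ℝ => (t : ℂ) ^ (n + 1)) (((n : ℂ) + 1) * (t : ℂ) ^ n) t := by
      simpa using (ofRealCLM.hasDerivAt (x := t)).fun_pow (n + 1)
    refine (h4.mul h3).congr_deriv ?_
    ring

/-! ### A maximum principle of Miller–Mocanu type -/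

/-- At a point of a closed disk centred at `0` where `Re P` is maximal, `z P' z` is real and
nonnegative. -/
theorem mul_deriv_of_isMaxOn_re {P : ℂ → ℂ} {z : ℂ} (hP : DifferentiableAt ℂ P z)
    (hmax : IsMaxOn (fun w => (P w).re) (closedBall 0 ‖z‖) z) :
    0 ≤ (z * deriv P z).re ∧ (z * deriv P z).im = 0 := by
  constructor
  -- Radial variation: `t = 1` is an end point, so only a sign results. The rotation `exp(it) z`
  -- below is two-sided and gives an equality.
  · have h2 : HasDerivAt (fun t : ℝ => (t : ℂ) * z) z 1 := by
      simpa using (ofRealCLM.hasDerivAt (x := (1 : ℝ))).mul_const z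
    have hP' : HasDerivAt P (deriv P z) (((1 : ℝ) : ℂ) * z) := by simpa using hP.hasDerivAt
    have h3 : HasDerivAt (fun t : ℝ => P ((t : ℂ) * z)) (deriv P z * z) 1 := hP'.comp 1 h2
    have h4 : HasDerivAt (fun t : ℝ => (P ((t : ℂ) * z)).re) (z * deriv P z).re 1 := by
      rw [mul_comm]
      exact reCLM.hasFDerivAt.comp_hasDerivAt (1 : ℝ) h3
    by_contra! hneg
    have h6 : IsLocalMaxOn (fun t : ℝ => (P ((t : ℂ) * z)).re) (Icc 0 1) 1 := by
      refine IsMaxOn.localize fun t ht => ?_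
      have := hmax (a := (t : ℂ) * z) (by
        rw [mem_closedBall_zero_iff, norm_mul, norm_real, Real.norm_of_nonneg ht.1]
        exact mul_le_of_le_one_left (norm_nonneg _) ht.2)
      simpa using this
    have h7 := h6.hasFDerivWithinAt_nonpos h4.hasFDerivAt.hasFDerivWithinAt (y := -1)
      (mem_posTangentConeAt_of_segment_subset (by
        rw [segment_symm, segment_eq_Icc (by norm_num)]
        norm_num))
    simp at h7
    simp at hneg
    linarith
  · have h2 : HasDerivAt (fun t : ℝ => exp ((t : ℂ) * I) * z) (I * z) 0 := by
      have := ((((ofRealCLM.hasDerivAt (x := (0 : ℝ))).mul_const I)).cexp).mul_const z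
      simpa using this
    have hP' : HasDerivAt P (deriv P z) (exp (((0 : ℝ) : ℂ) * I) * z) := by
      simpa using hP.hasDerivAt
    have h3 : HasDerivAt (fun t : ℝ => P (exp ((t : ℂ) * I) * z)) (deriv P z * (I * z)) 0 :=
      hP'.comp 0 h2
    have h4 : HasDerivAt (fun t : ℝ => (P (exp ((t : ℂ) * I) * z)).re)
        (deriv P z * (I * z)).re 0 :=
      reCLM.hasFDerivAt.comp_hasDerivAt (0 : ℝ) h3
    have h5 : IsLocalMax (fun t : ℝ => (P (exp ((t : ℂ) * I) * z)).re) 0 := by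
      refine .of_forall fun t => ?_
      have := hmax (a := exp ((t : ℂ) * I) * z) (by
        simp [norm_exp_ofReal_mul_I])
      simpa using this
    have h6 := h5.hasDerivAt_eq_zero h4
    have h7 : deriv P z * (I * z) = I * (z * deriv P z) := by ring
    rw [h7, I_mul_re] at h6
    linarith

/-- A Miller–Mocanu type bound: if `Re s ≥ 0` then `Re P` is dominated by the real part of
`P + s z P'`. -/
theorem exists_re_le_re_add_mul_deriv {P s : ℂ → ℂ} (hP : DifferentiableOn ℂ P (ball 0 1))
    (hs : ∀ z ∈ ball (0 : ℂ) 1, 0 ≤ (s z).re) {w : ℂ} (hw : w ∈ ball (0 : ℂ) 1) :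
    ∃ z ∈ ball (0 : ℂ) 1, (P w).re ≤ (P z + s z * (z * deriv P z)).re := by
  have hsub : closedBall (0 : ℂ) ‖w‖ ⊆ ball 0 1 :=
    closedBall_subset_ball (mem_ball_zero_iff.1 hw)
  obtain ⟨z, hz, hmax⟩ := (isCompact_closedBall (0 : ℂ) ‖w‖).exists_isMaxOn
    ⟨0, by simp⟩ (continuous_re.comp_continuousOn (hP.continuousOn.mono hsub))
  refine ⟨z, hsub hz, ?_⟩
  have hPz := hP.differentiableAt (isOpen_ball.mem_nhds (hsub hz))
  obtain ⟨h1, h2⟩ := mul_deriv_of_isMaxOn_re hPz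
    (hmax.on_subset (closedBall_subset_closedBall (by simpa using hz)))
  have h3 : (P w).re ≤ (P z).re := hmax (a := w) (by simp)
  have h4 := mul_nonneg (hs z (hsub hz)) h1
  rw [add_re, mul_re, h2]
  linarith

/-! ### Möbius estimates for the denominator -/

theorem re_div_eq (w v : ℂ) : (w / v).re = (w * conj v).re / normSq v := by
  rw [div_re, mul_re, conj_re, conj_im]
  ring

theorem re_div_pos {w v : ℂ} (h : 0 < (w * conj v).re) : 0 < (w / v).re := by
  have hv : v ≠ 0 := by rintro rfl; simp at h
  rw [re_div_eq]
  exact div_pos h (normSq_pos.2 hv)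

theorem re_div_neg {w v : ℂ} (h : (w * conj v).re < 0) : (w / v).re < 0 := by
  have hv : v ≠ 0 := by rintro rfl; simp at h
  rw [re_div_eq]
  exact div_neg_of_neg_of_pos h (normSq_pos.2 hv)

/-- This Möbius map has its pole outside the closed disk, vanishes at `1` and has derivative `1`
there, so it maps the closed disk onto a disk in the left half-plane tangent to the imaginary axis
at `0`. -/
theorem re_sub_one_mul_moebius_neg {A B y : ℂ} (hAB : ‖B‖ < ‖A‖) (hy : ‖y‖ ≤ 1) (hy1 : y ≠ 1) :
    ((y - 1) * (A + B) / (A + B * y)).re < 0 := by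
  apply re_div_neg
  have hc : |(B * conj A).re| ≤ ‖A‖ * ‖B‖ := by
    refine (abs_re_le_norm _).trans ?_
    rw [norm_mul, norm_conj, mul_comm]
  have hA : A.re ^ 2 + A.im ^ 2 = ‖A‖ ^ 2 := by rw [← normSq_eq_norm_sq, normSq_apply]; ring
  have hB : B.re ^ 2 + B.im ^ 2 = ‖B‖ ^ 2 := by rw [← normSq_eq_norm_sq, normSq_apply]; ring
  have hY : y.re ^ 2 + y.im ^ 2 ≤ 1 := by
    have : y.re ^ 2 + y.im ^ 2 = ‖y‖ ^ 2 := by rw [← normSq_eq_norm_sq, normSq_apply]; ring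
    rw [this]
    exact pow_le_one₀ (norm_nonneg _) hy
  have hk : y.re < 1 := by
    refine lt_of_le_of_ne (by nlinarith [sq_nonneg y.im]) fun h => hy1 ?_
    apply Complex.ext
    · simpa using h
    · rw [h] at hY
      simpa using pow_eq_zero_iff (two_ne_zero) |>.1 (le_antisymm (by linarith) (sq_nonneg y.im))
  have key : ((y - 1) * (A + B) * conj (A + B * y)).re =
      ‖A‖ ^ 2 * (y.re - 1) + ‖B‖ ^ 2 * (y.re ^ 2 + y.im ^ 2 - y.re) +
        (B * conj A).re * (y.re ^ 2 + y.im ^ 2 - 1) := by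
    rw [← hA, ← hB]
    simp
    ring
  rw [key]
  -- Together the estimates below bound the expression by `-(‖A‖ - ‖B‖)² (1 - Re y)`.
  have hs : 1 - (y.re ^ 2 + y.im ^ 2) ≤ 2 * (1 - y.re) := by
    nlinarith [sq_nonneg (1 - y.re), sq_nonneg y.im]
  have h1 := mul_le_mul_of_nonneg_right (neg_le_of_abs_le hc) (sub_nonneg.2 hY)
  have h2 := mul_le_mul_of_nonneg_left hs
    (mul_nonneg (norm_nonneg B) (sub_nonneg.2 hAB.le))
  have h3 := mul_pos (pow_pos (sub_pos.2 hAB) 2) (sub_pos.2 hk)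
  nlinarith

theorem norm_conj_sub_le {lam z : ℂ} (hlam : ‖lam‖ ≤ 1) (hz : ‖z‖ ≤ 1) :
    ‖conj lam - z‖ ≤ ‖1 - lam * z‖ := by
  refine le_of_sq_le_sq ?_ (norm_nonneg _)
  have h : ‖1 - lam * z‖ ^ 2 - ‖conj lam - z‖ ^ 2 = (1 - ‖lam‖ ^ 2) * (1 - ‖z‖ ^ 2) := by
    simp only [← normSq_eq_norm_sq, normSq_apply]
    simp
    ring
  have h1 : ‖lam‖ ^ 2 ≤ 1 := pow_le_one₀ (norm_nonneg _) hlam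
  have h2 : ‖z‖ ^ 2 ≤ 1 := pow_le_one₀ (norm_nonneg _) hz
  nlinarith [mul_nonneg (sub_nonneg.2 h1) (sub_nonneg.2 h2)]

theorem norm_conj_sub_mul_lt {lam z : ℂ} (hlam : ‖lam‖ ≤ 1) (hz : ‖z‖ < 1) :
    ‖(conj lam - z) * z‖ < ‖1 - lam * z‖ := by
  have h0 : 0 < ‖1 - lam * z‖ := by
    rw [norm_pos_iff, sub_ne_zero]
    intro h
    have := congrArg norm h
    rw [norm_one, norm_mul] at this
    nlinarith [mul_le_of_le_one_left (norm_nonneg z) hlam]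
  rw [norm_mul]
  calc ‖conj lam - z‖ * ‖z‖ ≤ ‖1 - lam * z‖ * ‖z‖ :=
        mul_le_mul_of_nonneg_right (norm_conj_sub_le hlam hz.le) (norm_nonneg _)
    _ < ‖1 - lam * z‖ := mul_lt_of_lt_one_right h0 hz

/-- The denominator `1 + conj lam x z - (x z + lam) z` of the extremal integrand. -/
noncomputable def den (lam x z : ℂ) : ℂ := 1 + conj lam * x * z - (x * z + lam) * z

theorem den_eq (lam x z : ℂ) : den lam x z = (1 - lam * z) + (conj lam - z) * z * x := by
  rw [den]; ring

theorem den_ne_zero {lam x z : ℂ} (hlam : ‖lam‖ ≤ 1) (hx : ‖x‖ ≤ 1) (hz : ‖z‖ < 1) :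
    den lam x z ≠ 0 := by
  rw [den_eq]
  intro h
  have h1 := norm_conj_sub_mul_lt hlam hz
  have h2 : ‖1 - lam * z‖ = ‖(conj lam - z) * z‖ * ‖x‖ := by
    rw [eq_neg_of_add_eq_zero_left h, norm_neg, norm_mul _ x]
  nlinarith [mul_le_of_le_one_right (norm_nonneg ((conj lam - z) * z)) hx]

theorem re_div_sub_one_mul_den_neg {lam a x z : ℂ} (hlam : ‖lam‖ ≤ 1) (ha : ‖a‖ = 1)
    (hx : ‖x‖ ≤ 1) (hxa : x ≠ a) (hz : ‖z‖ < 1) :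
    ((x / a - 1) * den lam a z / den lam x z).re < 0 := by
  have ha0 : a ≠ 0 := by rintro rfl; simp at ha
  have h := re_sub_one_mul_moebius_neg (A := 1 - lam * z) (B := (conj lam - z) * z * a)
    (y := x / a) (by rw [norm_mul, ha, mul_one]; exact norm_conj_sub_mul_lt hlam hz)
    (by rwa [norm_div, ha, div_one]) (by rwa [ne_eq, div_eq_one_iff_eq ha0])
  rwa [mul_assoc _ a, mul_div_cancel₀ _ ha0, ← den_eq, ← den_eq] at h

theorem re_one_add_mul_sq_div_den_pos {lam a z : ℂ} (hlam : ‖lam‖ < 1) (ha : ‖a‖ = 1)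
    (hz : ‖z‖ < 1) : 0 < ((1 + a * z ^ 2) / den lam a z).re := by
  apply re_div_pos
  have h1 : a.re ^ 2 + a.im ^ 2 = 1 := by
    have : a.re ^ 2 + a.im ^ 2 = ‖a‖ ^ 2 := by rw [← normSq_eq_norm_sq, normSq_apply]; ring
    rw [this, ha, one_pow]
  have h2 : z.re ^ 2 + z.im ^ 2 = ‖z‖ ^ 2 := by rw [← normSq_eq_norm_sq, normSq_apply]; ring
  -- The second summand vanishes for `|a| = 1`; the first is positive since `1 + |z|² ≥ 2|z| >
  -- 2|lam||z|` for `z ≠ 0`.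
  have key : ((1 + a * z ^ 2) * conj (den lam a z)).re =
      (1 - ‖z‖ ^ 2) * (1 + ‖z‖ ^ 2 + ((conj lam * a - lam) * z).re) +
        (a.re ^ 2 + a.im ^ 2 - 1) * ((z.re ^ 2 + z.im ^ 2) *
          (-(z.re ^ 2 + z.im ^ 2) + lam.re * z.re - lam.im * z.im)) := by
    rw [← h2, den]
    simp [pow_two]
    ring
  rw [key, h1, sub_self, zero_mul, add_zero]
  have h3 : |((conj lam * a - lam) * z).re| ≤ 2 * ‖lam‖ * ‖z‖ := by
    refine (abs_re_le_norm _).trans ?_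
    rw [norm_mul]
    refine mul_le_mul_of_nonneg_right ((norm_sub_le _ _).trans ?_) (norm_nonneg _)
    rw [norm_mul, norm_conj, ha]
    linarith
  have h4 := neg_le_of_abs_le h3
  have h5 := norm_nonneg z
  refine mul_pos (by nlinarith) ?_
  rcases h5.eq_or_lt with h | h
  · rw [← h] at h4 ⊢
    linarith
  · nlinarith [mul_pos h (sub_pos.2 hlam), sq_nonneg (1 - ‖z‖)]

theorem differentiable_den (lam a : ℂ) : Differentiable ℂ (den lam a) := by
  unfold den; fun_prop

theorem differentiableOn_den_comp (lam : ℂ) {h : ℂ → ℂ} {s : Set ℂ} (hh : DifferentiableOn ℂ h s) :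
    DifferentiableOn ℂ (fun z => den lam (h z) z) s := by
  unfold den; fun_prop

theorem hasDerivAt_den (lam a z : ℂ) :
    HasDerivAt (den lam a) (conj lam * a - lam - 2 * a * z) z := by
  have h : HasDerivAt (fun z => 1 + conj lam * a * z - (a * z + lam) * z)
      (conj lam * a * 1 - ((a * 1) * z + (a * z + lam) * 1)) z :=
    (((hasDerivAt_id z).const_mul (conj lam * a)).const_add 1).sub
      ((((hasDerivAt_id z).const_mul a).add_const lam).mul (hasDerivAt_id z))
  exact h.congr_deriv (by ring)

/-! ### Starlikeness of the comparison function -/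

/-- `z⁻³ ∫₀ᶻ ζ² / den lam a ζ ² dζ`, the nonvanishing part of the `3`-valent starlike function
which governs the supporting lines of the region of variability. -/
noncomputable def supportFactor (lam a : ℂ) : ℂ → ℂ :=
  radialMean 2 fun z => 1 / den lam a z ^ 2

theorem differentiableOn_one_div_den_sq {lam a : ℂ} (hlam : ‖lam‖ < 1) (ha : ‖a‖ = 1) :
    DifferentiableOn ℂ (fun z => 1 / den lam a z ^ 2) (ball 0 1) :=
  ((differentiableOn_const 1).div ((differentiable_den lam a).differentiableOn.pow 2)
    fun _ hz => pow_ne_zero 2 (den_ne_zero hlam.le ha.le (mem_ball_zero_iff.1 hz)))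

theorem supportFactor_ode {lam a z : ℂ} (hlam : ‖lam‖ < 1) (ha : ‖a‖ = 1)
    (hz : z ∈ ball (0 : ℂ) 1) :
    3 * supportFactor lam a z + z * deriv (supportFactor lam a) z = 1 / den lam a z ^ 2 := by
  rw [← radialMean_add_mul_deriv (differentiableOn_one_div_den_sq hlam ha) 2 hz, supportFactor]
  push_cast
  ring

/-- The reciprocal of the logarithmic derivative of the starlike function `z³ supportFactor`. -/
noncomputable def starQuotient (lam a z : ℂ) : ℂ := supportFactor lam a z * den lam a z ^ 2

theorem differentiableOn_supportFactor {lam a : ℂ} (hlam : ‖lam‖ < 1) (ha : ‖a‖ = 1) :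
    DifferentiableOn ℂ (supportFactor lam a) (ball 0 1) :=
  differentiableOn_radialMean (differentiableOn_one_div_den_sq hlam ha) 2

theorem differentiableOn_starQuotient {lam a : ℂ} (hlam : ‖lam‖ < 1) (ha : ‖a‖ = 1) :
    DifferentiableOn ℂ (starQuotient lam a) (ball 0 1) :=
  (differentiableOn_supportFactor hlam ha).mul ((differentiable_den lam a).differentiableOn.pow 2)

/-- Multiply `supportFactor_ode` by `den²` and use `1 + a z² = den - z den'`. -/
theorem starQuotient_ode {lam a z : ℂ} (hlam : ‖lam‖ < 1) (ha : ‖a‖ = 1)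
    (hz : z ∈ ball (0 : ℂ) 1) :
    (1 + 2 * ((1 + a * z ^ 2) / den lam a z)) * starQuotient lam a z +
      z * deriv (starQuotient lam a) z = 1 := by
  have hd := den_ne_zero hlam.le ha.le (mem_ball_zero_iff.1 hz)
  have hΓ := ((differentiableOn_supportFactor hlam ha).differentiableAt
    (isOpen_ball.mem_nhds hz)).hasDerivAt
  have h1 : deriv (starQuotient lam a) z = _ := (hΓ.mul ((hasDerivAt_den lam a z).fun_pow 2)).deriv
  have h2 := supportFactor_ode hlam ha hz
  rw [h1, starQuotient]
  have h3 : z * deriv (supportFactor lam a) z =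
      1 / den lam a z ^ 2 - 3 * supportFactor lam a z := by rw [← h2]; ring
  have h4 : z * (deriv (supportFactor lam a) z * den lam a z ^ 2) =
      1 - 3 * supportFactor lam a z * den lam a z ^ 2 := by
    rw [← mul_assoc, h3]; field_simp
  have h5 : (1 + a * z ^ 2) / den lam a z * (supportFactor lam a z * den lam a z ^ 2) =
      (1 + a * z ^ 2) * supportFactor lam a z * den lam a z := by
    field_simp
  rw [add_mul, mul_assoc 2, h5, mul_add, h4]
  have h6 : 1 + a * z ^ 2 = den lam a z - z * (conj lam * a - lam - 2 * a * z) := by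
    rw [den]; ring
  rw [h6]
  push_cast
  ring

/-- Dividing the equation for `S = starQuotient` by its coefficient `k` of `S`, where `Re k > 0`,
gives `S + (1/k) z S' = 1/k`. The maximum principle applied to `-S` then yields the sign. -/
theorem re_starQuotient_pos {lam a z : ℂ} (hlam : ‖lam‖ < 1) (ha : ‖a‖ = 1)
    (hz : z ∈ ball (0 : ℂ) 1) : 0 < (starQuotient lam a z).re := by
  have hE : ∀ w ∈ ball (0 : ℂ) 1, 0 < (1 / (1 + 2 * ((1 + a * w ^ 2) / den lam a w))).re := by
    intro w hw
    have := re_one_add_mul_sq_div_den_pos hlam ha (mem_ball_zero_iff.1 hw)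
    apply re_div_pos
    rw [one_mul, conj_re]
    simp only [add_re, one_re, mul_re, re_ofNat, im_ofNat]
    linarith
  obtain ⟨w, hw, h⟩ := exists_re_le_re_add_mul_deriv
    (differentiableOn_starQuotient hlam ha).neg (fun w hw => (hE w hw).le) hz
  have h0 : 1 + 2 * ((1 + a * w ^ 2) / den lam a w) ≠ 0 := by
    intro h0
    have := hE w hw
    simp [h0] at this
  have h1 := starQuotient_ode hlam ha hw
  have h2 : (-starQuotient lam a) w + 1 / (1 + 2 * ((1 + a * w ^ 2) / den lam a w)) *
      (w * deriv (-starQuotient lam a) w) = -(1 / (1 + 2 * ((1 + a * w ^ 2) / den lam a w))) := by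
    rw [deriv.neg, Pi.neg_apply, one_div_mul_eq_div, eq_neg_iff_add_eq_zero, add_assoc,
      ← add_div, neg_add_eq_zero, eq_div_iff h0]
    linear_combination h1
  rw [h2, Pi.neg_apply, neg_re, neg_re] at h
  linarith [hE w hw]

theorem supportFactor_ne_zero {lam a z : ℂ} (hlam : ‖lam‖ < 1) (ha : ‖a‖ = 1)
    (hz : z ∈ ball (0 : ℂ) 1) : supportFactor lam a z ≠ 0 := by
  intro h
  have := re_starQuotient_pos hlam ha hz
  simp [starQuotient, h] at this

/-- The comparison of a holomorphic radial mean with the extremal one. -/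
theorem re_radialMean_div_supportFactor_neg {lam a : ℂ} (hlam : ‖lam‖ < 1) (ha : ‖a‖ = 1)
    {q : ℂ → ℂ} (hq : DifferentiableOn ℂ q (ball 0 1)) (hneg : ∀ z ∈ ball (0 : ℂ) 1, (q z).re < 0)
    {z : ℂ} (hz : z ∈ ball (0 : ℂ) 1) :
    (radialMean 2 (fun w => q w * (1 / den lam a w ^ 2)) z / supportFactor lam a z).re < 0 := by
  have hφ := hq.mul (differentiableOn_one_div_den_sq hlam ha)
  set Q := radialMean 2 (fun w => q w * (1 / den lam a w ^ 2)) with hQ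
  have hQd : DifferentiableOn ℂ Q (ball 0 1) := differentiableOn_radialMean hφ 2
  have hΓ := differentiableOn_supportFactor hlam ha
  have hP : DifferentiableOn ℂ (fun w => Q w / supportFactor lam a w) (ball 0 1) :=
    hQd.div hΓ fun w hw => supportFactor_ne_zero hlam ha hw
  -- For `P = Q / supportFactor` the two radial mean equations combine to `P + starQuotient * z P' =
  -- q`.
  obtain ⟨w, hw, h⟩ := exists_re_le_re_add_mul_deriv hP
    (fun w hw => (re_starQuotient_pos hlam ha hw).le) hz
  refine (h.trans_eq ?_).trans_lt (hneg w hw)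
  congr 1
  have h0 := supportFactor_ne_zero hlam ha hw
  have hd := den_ne_zero hlam.le ha.le (mem_ball_zero_iff.1 hw)
  have h1 : 3 * Q w + w * deriv Q w = q w * (1 / den lam a w ^ 2) := by
    have := radialMean_add_mul_deriv hφ 2 hw
    push_cast at this
    change (2 + 1) * Q w + w * deriv Q w = q w * (1 / den lam a w ^ 2) at this
    rw [← this]
    ring
  have h2 := supportFactor_ode hlam ha hw
  have hnhds := isOpen_ball.mem_nhds hw
  rw [(((hQd.differentiableAt hnhds).hasDerivAt).fun_div
    ((hΓ.differentiableAt hnhds).hasDerivAt) h0).deriv, starQuotient]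
  generalize deriv Q w = Q' at *
  generalize deriv (supportFactor lam a) w = Γ' at *
  generalize supportFactor lam a w = Γ at *
  generalize den lam a w = d at *
  generalize Q w = R at *
  field_simp at h1 h2 ⊢
  linear_combination Γ * h1 - R * h2

/-! ### Extremal functions and the Schwarz function representation -/

/-- The integrand `(x z + lam) z / den lam x z`. -/
noncomputable def integrand (lam x z : ℂ) : ℂ := (x * z + lam) * z / den lam x z

theorem differentiableOn_integrand {lam : ℂ} (hlam : ‖lam‖ < 1) {h : ℂ → ℂ}
    (hd : DifferentiableOn ℂ h (ball 0 1)) (hh : ∀ z ∈ ball (0 : ℂ) 1, ‖h z‖ ≤ 1) :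
    DifferentiableOn ℂ (fun z => integrand lam (h z) z) (ball 0 1) :=
  (((hd.mul differentiableOn_id).add_const lam).mul differentiableOn_id).div
    (differentiableOn_den_comp lam hd)
    fun z hz => den_ne_zero hlam.le (hh z hz) (mem_ball_zero_iff.1 hz)

/-- The quantity is a Cayley transform `(U + W)/(U - W)` with `|W| < |U|`. -/
theorem re_one_add_two_mul_integrand_pos {lam a z : ℂ} (hlam : ‖lam‖ < 1) (ha : ‖a‖ ≤ 1)
    (hz : ‖z‖ < 1) : 0 < (1 + 2 * integrand lam a z).re := by
  have hd := den_ne_zero hlam.le ha hz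
  have haz : ‖a * z‖ ≤ 1 := by
    rw [norm_mul]; exact mul_le_one₀ ha (norm_nonneg _) hz.le
  have h1 : ‖(a * z + lam) * z‖ < ‖1 + conj lam * (a * z)‖ := by
    have := norm_conj_sub_le (lam := conj lam) (z := -(a * z)) (by rw [norm_conj]; exact hlam.le)
      (by rwa [norm_neg])
    rw [conj_conj, sub_neg_eq_add, mul_neg, sub_neg_eq_add, add_comm lam] at this
    rw [norm_mul]
    have h0 : 0 < ‖1 + conj lam * (a * z)‖ := by
      rw [norm_pos_iff]
      intro h
      have h' := congrArg norm (eq_neg_of_add_eq_zero_right h)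
      rw [norm_neg, norm_one, norm_mul, norm_conj] at h'
      nlinarith [mul_le_of_le_one_right (norm_nonneg lam) haz]
    exact (mul_le_mul_of_nonneg_right this (norm_nonneg _)).trans_lt (mul_lt_of_lt_one_right h0 hz)
  have h2 : 1 + 2 * integrand lam a z =
      (1 + conj lam * (a * z) + (a * z + lam) * z) / den lam a z := by
    rw [integrand]
    field_simp
    rw [den]
    ring
  rw [h2]
  apply re_div_pos
  have h3 : den lam a z = 1 + conj lam * (a * z) - (a * z + lam) * z := by rw [den]; ring
  rw [h3]
  generalize 1 + conj lam * (a * z) = U at *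
  generalize (a * z + lam) * z = W at *
  have h4 : ((U + W) * conj (U - W)).re = ‖U‖ ^ 2 - ‖W‖ ^ 2 := by
    simp only [← normSq_eq_norm_sq, normSq_apply]
    simp
    ring
  rw [h4, sub_pos]
  gcongr

theorem hasDerivAt_extremalH {β : ℝ} {lam a z : ℂ} (hlam : ‖lam‖ < 1) (ha : ‖a‖ ≤ 1)
    (hz : z ∈ ball (0 : ℂ) 1) :
    HasDerivAt (extremalH β a lam) (1 + 2 * (1 - (β : ℂ)) * integrand lam a z) z := by
  have hd := differentiableOn_integrand hlam (differentiableOn_const a) (fun _ _ => ha)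
  have h1 : extremalH β a lam =
      fun w => w + 2 * (1 - (β : ℂ)) * (radialMean 0 (integrand lam a) w * w) := by
    funext w
    rw [extremalH, integralFromZero, radialMean, ← intervalIntegral.integral_mul_const]
    simp only [integrand, den, pow_zero, one_mul]
  rw [h1]
  have h2 := hasDerivAt_radialMean hd 0 hz
  have h3 := radialMean_add_mul_deriv hd 0 hz
  rw [h2.deriv] at h3
  have h4 := (hasDerivAt_id z).add ((h2.mul (hasDerivAt_id z)).const_mul (2 * (1 - (β : ℂ))))
  refine h4.congr_deriv ?_
  rw [← h3]
  simp only [id, mul_one, Nat.cast_zero, zero_add, one_mul]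
  ring

theorem extremalH_zero (β : ℝ) (a lam : ℂ) : extremalH β a lam 0 = 0 := by
  simp [extremalH, integralFromZero]

theorem extremalH_mem_classR {β : ℝ} (hβ : β < 1) {lam a : ℂ} (hlam : ‖lam‖ < 1) (ha : ‖a‖ ≤ 1) :
    extremalH β a lam ∈ classR β lam := by
  have hH := fun z hz => hasDerivAt_extremalH (β := β) (z := z) hlam ha hz
  have h0 : (0 : ℂ) ∈ ball (0 : ℂ) 1 := by simp
  refine ⟨⟨⟨fun z hz => (hH z hz).differentiableAt.differentiableWithinAt, extremalH_zero _ _ _,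
    ?_⟩, fun z hz => ?_⟩, ?_⟩
  · rw [(hH 0 h0).deriv]
    simp [integrand]
  · rw [(hH z hz).deriv]
    have h1 := re_one_add_two_mul_integrand_pos hlam ha (mem_ball_zero_iff.1 hz)
    have h2 : 1 + 2 * (1 - (β : ℂ)) * integrand lam a z =
        β + ((1 - β : ℝ) : ℂ) * (1 + 2 * integrand lam a z) := by
      push_cast; ring
    rw [h2, add_re, ofReal_re, re_ofReal_mul]
    linarith [mul_pos (sub_pos.2 hβ) h1]
  · have h1 : deriv (extremalH β a lam) =ᶠ[𝓝 0]
        fun z => 1 + 2 * (1 - (β : ℂ)) * (z * ((a * z + lam) / den lam a z)) := by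
      filter_upwards [isOpen_ball.mem_nhds h0] with z hz
      rw [(hH z hz).deriv, integrand]
      ring
    have hM : DifferentiableAt ℂ (fun z => (a * z + lam) / den lam a z) 0 := by
      refine DifferentiableAt.div (by fun_prop) (differentiable_den lam a 0) ?_
      exact den_ne_zero hlam.le ha (by simp)
    have h2 := (((hasDerivAt_id (0 : ℂ)).mul hM.hasDerivAt).const_mul
      (2 * (1 - (β : ℂ)))).const_add 1
    rw [h1.deriv_eq]
    refine h2.deriv.trans ?_
    simp [den]

/-- The Schwarz function of a member of `ℛ(lam)`. -/
theorem exists_deriv_eq_of_mem_classR {β : ℝ} (hβ : β < 1) {lam : ℂ} (hlam : ‖lam‖ < 1)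
    {f : ℂ → ℂ} (hf : f ∈ classR β lam) :
    ∃ h : ℂ → ℂ, DifferentiableOn ℂ h (ball 0 1) ∧ (∀ z ∈ ball (0 : ℂ) 1, ‖h z‖ ≤ 1) ∧
      ∀ z ∈ ball (0 : ℂ) 1, deriv f z = 1 + 2 * (1 - (β : ℂ)) * integrand lam (h z) z := by
  obtain ⟨⟨⟨hfd, -, hf1⟩, hre⟩, hf2⟩ := hf
  have h0 : (0 : ℂ) ∈ ball (0 : ℂ) 1 := by simp
  have hn0 : ball (0 : ℂ) 1 ∈ 𝓝 0 := isOpen_ball.mem_nhds h0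
  have hβ0 : (1 : ℂ) - β ≠ 0 := by
    rw [sub_ne_zero]; exact_mod_cast hβ.ne'
  have hd1 : DifferentiableOn ℂ (deriv f) (ball 0 1) := hfd.deriv isOpen_ball
  set p : ℂ → ℂ := fun z => (deriv f z - β) / (1 - β) with hp
  have hpd : DifferentiableOn ℂ p (ball 0 1) := (hd1.sub_const _).div_const _
  have hpre : ∀ z ∈ ball (0 : ℂ) 1, 0 < (p z).re := by
    intro z hz
    have : p z = (deriv f z - β) / ((1 - β : ℝ) : ℂ) := by simp [hp]
    rw [this, div_ofReal_re]
    exact div_pos (by simpa using hre z hz) (by linarith)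
  have hp1 : ∀ z ∈ ball (0 : ℂ) 1, p z + 1 ≠ 0 := by
    intro z hz h
    have := congrArg re h
    simp at this
    linarith [hpre z hz]
  have hp0 : p 0 = 1 := by simp [hp, hf1, hβ0]
  have hp'0 : HasDerivAt p (2 * lam) 0 := by
    have := ((hd1.differentiableAt hn0).hasDerivAt.sub_const (β : ℂ)).div_const (1 - (β : ℂ))
    refine this.congr_deriv ?_
    rw [hf2]
    field_simp
  -- The Cayley transform gives a self-map fixing `0` with derivative `lam`. Dividing by `z`, moving
  -- the value `lam` at `0` to `0`, and dividing by `z` again produces `h`.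
  set w : ℂ → ℂ := fun z => (p z - 1) / (p z + 1) with hw
  have hwd : DifferentiableOn ℂ w (ball 0 1) := (hpd.sub_const _).div (hpd.add_const _) hp1
  have hw0 : w 0 = 0 := by simp [hw, hp0]
  have hw'0 : deriv w 0 = lam := by
    have := (hp'0.sub_const 1).fun_div (hp'0.add_const 1) (hp1 0 h0)
    rw [this.deriv, hp0]
    ring
  have hwmaps : MapsTo w (ball 0 1) (closedBall (w 0) 1) := by
    intro z hz
    rw [hw0, mem_closedBall_zero_iff, hw, norm_div, div_le_one (norm_pos_iff.2 (hp1 z hz))]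
    refine le_of_sq_le_sq ?_ (norm_nonneg _)
    simp only [← normSq_eq_norm_sq, normSq_apply]
    simp
    nlinarith [hpre z hz]
  set ω : ℂ → ℂ := dslope w 0 with hω
  have hωd : DifferentiableOn ℂ ω (ball 0 1) := (differentiableOn_dslope hn0).2 hwd
  have hω1 : ∀ z ∈ ball (0 : ℂ) 1, ‖ω z‖ ≤ 1 := fun z hz => by
    simpa using norm_dslope_le_div_of_mapsTo_ball hwd hwmaps hz
  have hωw : ∀ z, w z = z * ω z := fun z => by
    simpa [hw0] using (sub_smul_dslope w 0 z).symm
  have hω0 : ω 0 = lam := by rw [hω, dslope_same, hw'0]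
  have hden : ∀ z ∈ ball (0 : ℂ) 1, 1 - conj lam * ω z ≠ 0 := by
    intro z hz h
    have h' := congrArg norm (sub_eq_zero.1 h)
    rw [norm_one, norm_mul, norm_conj] at h'
    nlinarith [mul_le_of_le_one_right (norm_nonneg lam) (hω1 z hz)]
  set g : ℂ → ℂ := fun z => (ω z - lam) / (1 - conj lam * ω z) with hg
  have hgd : DifferentiableOn ℂ g (ball 0 1) :=
    (hωd.sub_const _).div ((hωd.const_mul _).const_sub _) hden
  have hg0 : g 0 = 0 := by simp [hg, hω0]
  have hgmaps : MapsTo g (ball 0 1) (closedBall (g 0) 1) := by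
    intro z hz
    rw [hg0, mem_closedBall_zero_iff, hg, norm_div, div_le_one (norm_pos_iff.2 (hden z hz)),
      norm_sub_rev]
    simpa using norm_conj_sub_le (lam := conj lam) (z := ω z) (by simpa using hlam.le) (hω1 z hz)
  have hgh : ∀ z, g z = dslope g 0 z * z := fun z => by
    rw [mul_comm]
    simpa [hg0] using (sub_smul_dslope g 0 z).symm
  have hh1 : ∀ z ∈ ball (0 : ℂ) 1, ‖dslope g 0 z‖ ≤ 1 := fun z hz => by
    simpa using norm_dslope_le_div_of_mapsTo_ball hgd hgmaps hz
  refine ⟨dslope g 0, (differentiableOn_dslope hn0).2 hgd, hh1, fun z hz => ?_⟩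
  have hD := den_ne_zero hlam.le (hh1 z hz) (mem_ball_zero_iff.1 hz)
  rw [integrand]
  have hD' : den lam (dslope g 0 z) z = 1 + conj lam * g z - (g z + lam) * z := by
    rw [den, hgh]; ring
  rw [hD'] at hD ⊢
  rw [← hgh]
  have e1 : g z * (1 - conj lam * ω z) = ω z - lam := div_mul_cancel₀ _ (hden z hz)
  have e2 : w z * (p z + 1) = p z - 1 := div_mul_cancel₀ _ (hp1 z hz)
  have e3 : deriv f z = β + (1 - β) * p z := by
    simp only [hp]
    field_simp
    ring
  have e4 : p z - 1 = 2 * ((g z + lam) * z / (1 + conj lam * g z - (g z + lam) * z)) := by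
    rw [hωw] at e2
    clear_value p w ω g
    have e5 : g z + lam = ω z * (1 + conj lam * g z) := by linear_combination e1
    rw [← mul_div_assoc, eq_div_iff hD, e5]
    linear_combination -(1 + conj lam * g z) * e2
  rw [e3]
  linear_combination (1 - (β : ℂ)) * e4

/-! ### Supporting half-planes -/

/-- Both sides vanish at `0` and have equal derivatives: the difference of two Möbius values in `x`
factors, and `(z³ Q)' = z² (3 Q + z Q')`. -/
theorem extremalH_sub_eq {β : ℝ} {lam a : ℂ} (hlam : ‖lam‖ < 1) (ha : ‖a‖ = 1)
    {f h : ℂ → ℂ} (hf : DifferentiableOn ℂ f (ball 0 1)) (hf0 : f 0 = 0)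
    (hd : DifferentiableOn ℂ h (ball 0 1)) (hh : ∀ z ∈ ball (0 : ℂ) 1, ‖h z‖ ≤ 1)
    (hfh : ∀ z ∈ ball (0 : ℂ) 1, deriv f z = 1 + 2 * (1 - (β : ℂ)) * integrand lam (h z) z)
    {z : ℂ} (hz : z ∈ ball (0 : ℂ) 1) :
    f z - extremalH β a lam z = 2 * (1 - (β : ℂ)) * (1 - conj lam * lam) * a *
      (z ^ 3 * radialMean 2 (fun w => (h w / a - 1) * den lam a w / den lam (h w) w *
        (1 / den lam a w ^ 2)) z) := by
  have ha0 : a ≠ 0 := by rintro rfl; simp at ha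
  have hq : DifferentiableOn ℂ (fun w => (h w / a - 1) * den lam a w / den lam (h w) w)
      (ball 0 1) :=
    (((hd.div_const a).sub_const 1).mul (differentiable_den lam a).differentiableOn).div
      (differentiableOn_den_comp lam hd)
      fun w hw => den_ne_zero hlam.le (hh w hw) (mem_ball_zero_iff.1 hw)
  have hφ := hq.mul (differentiableOn_one_div_den_sq hlam ha)
  set Q := radialMean 2 (fun w => (h w / a - 1) * den lam a w / den lam (h w) w *
    (1 / den lam a w ^ 2)) with hQ
  have hQd : DifferentiableOn ℂ Q (ball 0 1) := differentiableOn_radialMean hφ 2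
  have hH := fun z hz => hasDerivAt_extremalH (β := β) (z := z) hlam ha.le hz
  refine isOpen_ball.eqOn_of_deriv_eq (convex_ball (0 : ℂ) 1).isPreconnected
    (f := fun z => f z - extremalH β a lam z)
    (g := fun z => 2 * (1 - (β : ℂ)) * (1 - conj lam * lam) * a * (z ^ 3 * Q z))
    (hf.sub fun z hz => (hH z hz).differentiableAt.differentiableWithinAt)
    (((differentiableOn_id.pow 3).mul hQd).const_mul _) ?_ (x := 0) (by simp)
    (by simp [hf0, extremalH_zero]) hz
  intro w hw
  have hnhds := isOpen_ball.mem_nhds hw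
  have h1 := ((hf.differentiableAt hnhds).hasDerivAt.fun_sub (hH w hw)).deriv
  have h2 := ((((hasDerivAt_id w).fun_pow 3).fun_mul
    (hQd.differentiableAt hnhds).hasDerivAt).const_mul
      (2 * (1 - (β : ℂ)) * (1 - conj lam * lam) * a)).deriv
  have h3 : (((2 : ℕ) : ℂ) + 1) * Q w + w * deriv Q w = (h w / a - 1) * den lam a w /
      den lam (h w) w * (1 / den lam a w ^ 2) := radialMean_add_mul_deriv hφ 2 hw
  refine h1.trans (Eq.trans ?_ h2.symm)
  have hd1 := den_ne_zero hlam.le (hh w hw) (mem_ball_zero_iff.1 hw)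
  have hd2 := den_ne_zero hlam.le ha.le (mem_ball_zero_iff.1 hw)
  have h4 : integrand lam (h w) w - integrand lam a w = (1 - conj lam * lam) * a *
      (w ^ 2 * ((h w / a - 1) * den lam a w / den lam (h w) w * (1 / den lam a w ^ 2))) := by
    simp only [integrand]
    field_simp
    simp only [den]
    ring
  rw [hfh w hw]
  rw [← h3] at h4
  simp only [id]
  push_cast at h4 ⊢
  linear_combination 2 * (1 - (β : ℂ)) * h4

/-- The normal to the supporting line of the region of variability at `extremalH β a lam z`. -/
noncomputable def supportNormal (lam z a : ℂ) : ℂ := a * (z ^ 3 * supportFactor lam a z)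

theorem supportNormal_ne_zero {lam a z : ℂ} (hlam : ‖lam‖ < 1) (ha : ‖a‖ = 1)
    (hz : z ∈ ball (0 : ℂ) 1) (hz0 : z ≠ 0) : supportNormal lam z a ≠ 0 := by
  have ha0 : a ≠ 0 := by rintro rfl; simp at ha
  exact mul_ne_zero ha0 (mul_ne_zero (pow_ne_zero 3 hz0) (supportFactor_ne_zero hlam ha hz))

/-- If `h` takes the unimodular value `a`, the maximum modulus principle makes it constant;
otherwise the Möbius estimate is strict on the whole disk. -/
theorem eqOn_or_re_sub_extremalH_div_neg {β : ℝ} (hβ : β < 1) {lam a : ℂ} (hlam : ‖lam‖ < 1)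
    (ha : ‖a‖ = 1) {f : ℂ → ℂ} (hf : f ∈ classR β lam) {z : ℂ} (hz : z ∈ ball (0 : ℂ) 1)
    (hz0 : z ≠ 0) :
    EqOn f (extremalH β a lam) (ball 0 1) ∨
      ((f z - extremalH β a lam z) / supportNormal lam z a).re < 0 := by
  obtain ⟨h, hd, hh, hfh⟩ := exists_deriv_eq_of_mem_classR hβ hlam hf
  have ha0 : a ≠ 0 := by rintro rfl; simp at ha
  by_cases hex : ∃ w ∈ ball (0 : ℂ) 1, h w = a
  · left
    obtain ⟨w, hw, hwa⟩ := hex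
    have hconst := eqOn_of_isPreconnected_of_isMaxOn_norm
      (convex_ball (0 : ℂ) 1).isPreconnected isOpen_ball hd hw (fun v hv => by
        simpa [hwa, ha] using hh v hv)
    have hH := fun z hz => hasDerivAt_extremalH (β := β) (z := z) hlam ha.le hz
    refine isOpen_ball.eqOn_of_deriv_eq (convex_ball (0 : ℂ) 1).isPreconnected hf.1.1.1
      (fun z hz => (hH z hz).differentiableAt.differentiableWithinAt) (fun v hv => ?_)
      (x := 0) (by simp) (by rw [hf.1.1.2.1, extremalH_zero])
    rw [hfh v hv, (hH v hv).deriv, hconst hv, Function.const_apply, hwa]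
  · right
    push Not at hex
    have hq : DifferentiableOn ℂ (fun w => (h w / a - 1) * den lam a w / den lam (h w) w)
        (ball 0 1) :=
      (((hd.div_const a).sub_const 1).mul (differentiable_den lam a).differentiableOn).div
        (differentiableOn_den_comp lam hd)
        fun w hw => den_ne_zero hlam.le (hh w hw) (mem_ball_zero_iff.1 hw)
    have key := re_radialMean_div_supportFactor_neg hlam ha hq (fun w hw =>
      re_div_sub_one_mul_den_neg hlam.le ha (hh w hw) (hex w hw) (mem_ball_zero_iff.1 hw)) hz
    rw [extremalH_sub_eq hlam ha hf.1.1.1 hf.1.1.2.1 hd hh hfh hz, supportNormal]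
    generalize radialMean 2 (fun w => (h w / a - 1) * den lam a w / den lam (h w) w *
      (1 / den lam a w ^ 2)) z = Q at *
    have hr : 2 * (1 - (β : ℂ)) * (1 - conj lam * lam) * a * (z ^ 3 * Q) /
        (a * (z ^ 3 * supportFactor lam a z)) =
        ((2 * (1 - β) * (1 - ‖lam‖ ^ 2) : ℝ) : ℂ) * (Q / supportFactor lam a z) := by
      have := supportFactor_ne_zero hlam ha hz
      push_cast
      rw [conj_mul']
      field_simp
    rw [hr, re_ofReal_mul]
    refine mul_neg_of_pos_of_neg (mul_pos (by linarith) ?_) key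
    rw [sub_pos]
    exact pow_lt_one₀ (norm_nonneg _) hlam two_ne_zero

/-! ### Dependence on the unimodular parameter -/

theorem continuous_radialMean_param {X : Type*} [TopologicalSpace X] [FirstCountableTopology X]
    [LocallyCompactSpace X] {φ : X → ℂ → ℂ}
    (hφ : ContinuousOn (fun p : X × ℂ => φ p.1 p.2) (univ ×ˢ ball 0 1)) (n : ℕ) {z : ℂ}
    (hz : z ∈ ball (0 : ℂ) 1) : Continuous fun x => radialMean n (φ x) z := by
  -- Clamping `t` to `[0, 1]` makes the integrand jointly continuous for all real `t`.
  have h1 : ∀ x, radialMean n (φ x) z = ∫ t in (0 : ℝ)..1,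
      ((projIcc (0 : ℝ) 1 zero_le_one t : ℝ) : ℂ) ^ n *
        φ x (((projIcc (0 : ℝ) 1 zero_le_one t : ℝ) : ℂ) * z) := by
    intro x
    refine intervalIntegral.integral_congr fun t ht => ?_
    rw [uIcc_of_le zero_le_one] at ht
    simp only [projIcc_of_mem _ ht]
  simp only [h1]
  refine intervalIntegral.continuous_parametric_intervalIntegral_of_continuous' ?_ 0 1
  have h2 : Continuous fun p : X × ℝ => ((projIcc (0 : ℝ) 1 zero_le_one p.2 : ℝ) : ℂ) :=
    continuous_ofReal.comp (continuous_subtype_val.comp (continuous_projIcc.comp continuous_snd))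
  refine (h2.pow n).mul ?_
  exact hφ.comp_continuous (continuous_fst.prodMk (h2.mul continuous_const))
    fun p => ⟨mem_univ _, ofReal_mul_mem_ball (projIcc (0 : ℝ) 1 zero_le_one p.2).2 hz⟩

theorem continuousOn_den_circle (lam : ℂ) (s : Set (Circle × ℂ)) :
    ContinuousOn (fun p : Circle × ℂ => den lam p.1 p.2) s := by
  unfold den; fun_prop

theorem den_circle_ne_zero {lam : ℂ} (hlam : ‖lam‖ < 1) :
    ∀ p ∈ (univ ×ˢ ball 0 1 : Set (Circle × ℂ)), den lam p.1 p.2 ≠ 0 :=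
  fun p hp => den_ne_zero hlam.le p.1.norm_coe.le (mem_ball_zero_iff.1 hp.2)

theorem continuous_supportFactor {lam z : ℂ} (hlam : ‖lam‖ < 1) (hz : z ∈ ball (0 : ℂ) 1) :
    Continuous fun a : Circle => supportFactor lam a z := by
  refine continuous_radialMean_param (φ := fun (a : Circle) w => 1 / den lam a w ^ 2) ?_ 2 hz
  exact continuousOn_const.div ((continuousOn_den_circle lam _).pow 2)
    fun p hp => pow_ne_zero 2 (den_circle_ne_zero hlam p hp)

theorem continuous_extremalH (β : ℝ) {lam z : ℂ} (hlam : ‖lam‖ < 1) (hz : z ∈ ball (0 : ℂ) 1) :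
    Continuous fun a : Circle => extremalH β a lam z := by
  have h1 : ∀ a : Circle, extremalH β a lam z =
      z + 2 * (1 - (β : ℂ)) * (radialMean 0 (integrand lam a) z * z) := by
    intro a
    rw [extremalH, integralFromZero, radialMean, ← intervalIntegral.integral_mul_const]
    simp only [integrand, den, pow_zero, one_mul]
  simp only [h1]
  have h2 := continuous_radialMean_param (φ := fun (a : Circle) w => integrand lam a w)
    (ContinuousOn.div (by fun_prop) (continuousOn_den_circle lam _) (den_circle_ne_zero hlam)) 0 hz
  fun_prop

theorem continuous_supportNormal {lam z : ℂ} (hlam : ‖lam‖ < 1) (hz : z ∈ ball (0 : ℂ) 1) :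
    Continuous fun a : Circle => supportNormal lam z a :=
  continuous_subtype_val.mul (continuous_const.mul (continuous_supportFactor hlam hz))

theorem eq_of_eqOn_extremalH {β : ℝ} (hβ : β < 1) {lam a b : ℂ} (hlam : ‖lam‖ < 1) (ha : ‖a‖ ≤ 1)
    (hb : ‖b‖ ≤ 1) (h : EqOn (extremalH β a lam) (extremalH β b lam) (ball 0 1)) : a = b := by
  -- Any nonzero point would serve; at `0` the derivative does not see `a`.
  have hz : (1 / 2 : ℂ) ∈ ball (0 : ℂ) 1 := by
    rw [mem_ball_zero_iff]; norm_num
  have h1 : deriv (extremalH β a lam) (1 / 2) = deriv (extremalH β b lam) (1 / 2) :=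
    (h.eventuallyEq_of_mem (isOpen_ball.mem_nhds hz)).deriv_eq
  rw [(hasDerivAt_extremalH hlam ha hz).deriv, (hasDerivAt_extremalH hlam hb hz).deriv] at h1
  have hβ0 : (1 : ℂ) - β ≠ 0 := by
    rw [sub_ne_zero]; exact_mod_cast hβ.ne'
  have h2 := mul_left_cancel₀ (mul_ne_zero two_ne_zero hβ0) (add_left_cancel h1)
  have hda := den_ne_zero hlam.le ha (mem_ball_zero_iff.1 hz)
  have hdb := den_ne_zero hlam.le hb (mem_ball_zero_iff.1 hz)
  rw [integrand, integrand, div_eq_div_iff hda hdb] at h2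
  have h3 : (1 - conj lam * lam) * (a - b) = 0 := by
    simp only [den] at h2
    linear_combination 4 * h2
  have h4 : 1 - conj lam * lam ≠ 0 := by
    rw [conj_mul', sub_ne_zero]
    have := pow_lt_one₀ (norm_nonneg lam) hlam two_ne_zero
    exact_mod_cast this.ne'
  exact sub_eq_zero.1 ((mul_eq_zero.1 h3).resolve_left h4)

/-- The normals of the supporting lines have every direction. -/
theorem exists_supportNormal_eq {lam z : ℂ} (hlam : ‖lam‖ < 1) (hz : z ∈ ball (0 : ℂ) 1)
    (hz0 : z ≠ 0) (c : ℂ) (hc : c ≠ 0) :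
    ∃ a : Circle, ∃ r : ℝ, 0 < r ∧ supportNormal lam z a = r * c := by
  have hz1 := mem_ball_zero_iff.1 hz
  let E : Circle → ℂ := fun a => (1 + a * z ^ 2) / den lam a z
  let N : Circle → ℂ := fun a => 1 + a * z ^ 2
  have hd (a : Circle) : den lam a z ≠ 0 := den_ne_zero hlam.le a.norm_coe.le hz1
  have hE (a : Circle) : 0 < (E a).re := re_one_add_mul_sq_div_den_pos hlam a.norm_coe hz1
  have hS (a : Circle) : 0 < (starQuotient lam a z).re := re_starQuotient_pos hlam a.norm_coe hz
  have hN (a : Circle) : 0 < (N a).re := by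
    have h1 : ‖(a : ℂ) * z ^ 2‖ < 1 := by
      rw [norm_mul, a.norm_coe, one_mul, norm_pow]
      exact pow_lt_one₀ (norm_nonneg _) hz1 two_ne_zero
    have h2 := neg_le_of_abs_le (abs_re_le_norm ((a : ℂ) * z ^ 2))
    simp only [N, add_re, one_re]
    linarith
  -- A continuous logarithm of `supportNormal / a = z³ S E² / N²`: principal logarithms are
  -- continuous because `S`, `E`, `N` stay in the right half-plane.
  let T : Circle → ℂ := fun a =>
    log (z ^ 3) + log (starQuotient lam a z) + 2 * log (E a) - 2 * log (N a)
  have hdc : Continuous fun a : Circle => den lam a z := by unfold den; fun_prop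
  have hNc : Continuous N := by fun_prop
  have hEc : Continuous E := hNc.div hdc hd
  have hSc : Continuous fun a : Circle => starQuotient lam a z :=
    (continuous_supportFactor hlam hz).mul (hdc.pow 2)
  have hTc : Continuous T :=
    ((continuous_const.add (hSc.clog fun a => .inl (hS a))).add
      (continuous_const.mul (hEc.clog fun a => .inl (hE a)))).sub
      (continuous_const.mul (hNc.clog fun a => .inl (hN a)))
  have hne {w : ℂ} (hw : 0 < w.re) : w ≠ 0 := by rintro rfl; simp at hw
  have hexp (a : Circle) : supportNormal lam z a = a * exp (T a) := by
    simp only [T]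
    rw [exp_sub, exp_add, exp_add, two_mul, two_mul, exp_add, exp_add,
      exp_log (pow_ne_zero 3 hz0), exp_log (hne (hS a)), exp_log (hne (hE a)),
      exp_log (hne (hN a)), supportNormal, starQuotient]
    have := hd a
    have := hne (hN a)
    simp only [E]
    change (1 + a * z ^ 2 : ℂ) ≠ 0 at this
    simp only [N]
    field_simp
  have hTb (a : Circle) : |(T a).im| ≤ 6 * Real.pi := by
    have h1 := abs_le.1 (abs_arg_le_pi (z ^ 3))
    have h2 := abs_le.1 (abs_arg_le_pi (starQuotient lam a z))
    have h3 := abs_le.1 (abs_arg_le_pi (E a))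
    have h4 := abs_le.1 (abs_arg_le_pi (N a))
    have h5 : (T a).im = arg (z ^ 3) + arg (starQuotient lam a z) + 2 * arg (E a) -
        2 * arg (N a) := by
      simp [T, log_im]
    rw [h5, abs_le]
    constructor <;> linarith [h1.1, h1.2, h2.1, h2.2, h3.1, h3.2, h4.1, h4.2]
  -- An argument of the normal at `exp(iθ)` is `θ` plus a bounded continuous term, so it takes every
  -- real value.
  have hsurj : Function.Surjective fun θ : ℝ => θ + (T (Circle.exp θ)).im := by
    refine Continuous.surjective
      (continuous_id.add (continuous_im.comp (hTc.comp Circle.exp.continuous))) ?_ ?_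
    · refine tendsto_atTop_mono (fun θ => ?_)
        (tendsto_atTop_add_const_right atTop (-(6 * Real.pi)) tendsto_id)
      have := (abs_le.1 (hTb (Circle.exp θ))).1
      simp only [id]
      linarith
    · refine tendsto_atBot_mono (fun θ => ?_)
        (tendsto_atBot_add_const_right atBot (6 * Real.pi) tendsto_id)
      have := (abs_le.1 (hTb (Circle.exp θ))).2
      simp only [id]
      linarith
  obtain ⟨θ, hθ⟩ := hsurj (arg c)
  refine ⟨Circle.exp θ, Real.exp (T (Circle.exp θ)).re / ‖c‖,
    div_pos (Real.exp_pos _) (norm_pos_iff.2 hc), ?_⟩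
  simp only at hθ
  have hc' : (‖c‖ : ℂ) ≠ 0 := by exact_mod_cast norm_ne_zero_iff.2 hc
  have h1 : (‖c‖ : ℂ) * (exp (θ * I) * exp ((T (Circle.exp θ)).im * I)) = c := by
    rw [← exp_add, ← add_mul, ← ofReal_add, hθ, norm_mul_exp_arg_mul_I]
  have h2 : exp (T (Circle.exp θ)) =
      exp (T (Circle.exp θ)).re * exp ((T (Circle.exp θ)).im * I) := by
    rw [← exp_add, re_add_im]
  rw [hexp, Circle.coe_exp, h2]
  push_cast
  rw [div_mul_eq_mul_div, eq_div_iff hc']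
  linear_combination exp (T (Circle.exp θ)).re * h1

/-! ### Convexity and compact hulls -/

theorem convex_variabilityRegion (β : ℝ) (z lam : ℂ) : Convex ℝ (variabilityRegion β z lam) := by
  rintro _ ⟨f, ⟨⟨⟨hf, hf0, hf1⟩, hfre⟩, hf2⟩, rfl⟩ _ ⟨g, ⟨⟨⟨hg, hg0, hg1⟩, hgre⟩, hg2⟩, rfl⟩
    s t hs ht hst
  have h0 : (0 : ℂ) ∈ ball (0 : ℂ) 1 := by simp
  have hst' : (s : ℂ) + t = 1 := by exact_mod_cast hst
  have hd : ∀ w ∈ ball (0 : ℂ) 1, deriv (fun w => (s : ℂ) * f w + t * g w) w =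
      s * deriv f w + t * deriv g w := fun w hw =>
    (((hf.differentiableAt (isOpen_ball.mem_nhds hw)).hasDerivAt.const_mul (s : ℂ)).add
      ((hg.differentiableAt (isOpen_ball.mem_nhds hw)).hasDerivAt.const_mul (t : ℂ))).deriv
  refine ⟨fun w => s * f w + t * g w, ⟨⟨⟨(hf.const_mul _).add (hg.const_mul _), ?_, ?_⟩, ?_⟩, ?_⟩,
    by simp⟩
  · simp [hf0, hg0]
  · rw [hd 0 h0, hf1, hg1, mul_one, mul_one, hst']
  · intro w hw
    rw [hd w hw, add_re, re_ofReal_mul, re_ofReal_mul]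
    have h1 := hfre w hw
    have h2 := hgre w hw
    have h3 : β = s * β + t * β := by rw [← add_mul, hst, one_mul]
    rcases hs.eq_or_lt with h | h
    · subst h
      have : t = 1 := by linarith
      subst this
      linarith
    · nlinarith [mul_lt_mul_of_pos_left h1 h, mul_le_mul_of_nonneg_left h2.le ht]
  · have h1 : deriv (fun w => (s : ℂ) * f w + t * g w) =ᶠ[𝓝 0]
        fun w => s * deriv f w + t * deriv g w := by
      filter_upwards [isOpen_ball.mem_nhds h0] with w hw using hd w hw
    have hn := isOpen_ball.mem_nhds h0
    rw [h1.deriv_eq]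
    refine (((((hf.deriv isOpen_ball).differentiableAt hn).hasDerivAt.const_mul (s : ℂ)).add
      (((hg.deriv isOpen_ball).differentiableAt hn).hasDerivAt.const_mul (t : ℂ))).deriv).trans ?_
    rw [hf2, hg2, ← add_mul, hst', one_mul]

/-- In a finite-dimensional space the convex hull of a compact set is compact. -/
theorem isCompact_convexHull_of_isCompact {E : Type*} [NormedAddCommGroup E] [NormedSpace ℝ E]
    [FiniteDimensional ℝ E] {s : Set E} (hs : IsCompact s) : IsCompact (convexHull ℝ s) := by
  let ι := Fin (Module.finrank ℝ E + 1)
  let Φ : (ι → ℝ) × (ι → E) → E := fun p => ∑ i, p.1 i • p.2 i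
  have hΦ : Continuous Φ := by fun_prop
  have hK : IsCompact (stdSimplex ℝ ι ×ˢ univ.pi fun _ : ι => s) :=
    (isCompact_stdSimplex ℝ ι).prod (isCompact_univ_pi fun _ => hs)
  convert hK.image hΦ
  apply Subset.antisymm
  · intro x hx
    rw [convexHull_eq_union] at hx
    simp only [mem_iUnion] at hx
    obtain ⟨t, hts, hti, hxt⟩ := hx
    have hcard : Fintype.card t ≤ Fintype.card ι := by
      simpa [ι] using hti.card_le_finrank_succ.trans
        (Nat.succ_le_succ (Submodule.finrank_le _))
    have ht : Nonempty t := by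
      obtain ⟨y, hy⟩ := convexHull_nonempty_iff.1 ⟨x, hxt⟩
      exact ⟨⟨y, hy⟩⟩
    obtain ⟨e⟩ := Function.Embedding.nonempty_of_card_le hcard
    -- Carathéodory may need fewer points than the index set has; the left inverse of `e` repeats
    -- points to fill it.
    let g : ι → E := fun i => (Function.invFun e i : t)
    have hg : range g = (t : Set E) := by
      change range (Subtype.val ∘ Function.invFun e) = _
      rw [range_comp, (Function.invFun_surjective e.injective).range_eq, image_univ,
        Subtype.range_coe]
    let L : (ι → ℝ) →ₗ[ℝ] E := Fintype.linearCombination ℝ g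
    have hL : L '' stdSimplex ℝ ι = convexHull ℝ (t : Set E) := by
      classical
      rw [← convexHull_rangle_single_eq_stdSimplex, LinearMap.image_convexHull, ← range_comp, ← hg]
      congr 2
      ext i
      simp [L, Fintype.linearCombination_apply_single]
    rw [← hL] at hxt
    obtain ⟨w, hw, rfl⟩ := hxt
    refine ⟨(w, g), ⟨hw, fun i _ => hts (hg ▸ mem_range_self i)⟩, ?_⟩
    simp [Φ, L, Fintype.linearCombination_apply]
  · rintro _ ⟨⟨w, g⟩, ⟨hw, hg⟩, rfl⟩
    exact (convex_convexHull ℝ s).sum_mem (fun i _ => hw.1 i) hw.2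
      fun i _ => subset_convexHull ℝ s (hg i (mem_univ i))

/-! ### The region as a convex hull and its frontier -/

variable {β : ℝ} {lam z : ℂ}

theorem extremalH_mem_variabilityRegion (hβ : β < 1) (hlam : ‖lam‖ < 1) (a : Circle) :
    extremalH β a lam z ∈ variabilityRegion β z lam :=
  ⟨_, extremalH_mem_classR hβ hlam a.norm_coe.le, rfl⟩

theorem eq_extremalH_or_re_neg (hβ : β < 1) (hlam : ‖lam‖ < 1) (hz : z ∈ ball (0 : ℂ) 1)
    (hz0 : z ≠ 0) {v : ℂ} (hv : v ∈ variabilityRegion β z lam) (a : Circle) :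
    v = extremalH β a lam z ∨ ((v - extremalH β a lam z) / supportNormal lam z a).re < 0 := by
  obtain ⟨f, hf, rfl⟩ := hv
  exact (eqOn_or_re_sub_extremalH_div_neg hβ hlam a.norm_coe hf hz hz0).imp_left fun h => h hz

/-- A point off the compact hull is strictly separated from it by a functional; the half-plane whose
normal points in the direction of that functional then excludes the point. -/
theorem mem_convexHull_of_re_nonpos (hlam : ‖lam‖ < 1) (hz : z ∈ ball (0 : ℂ) 1)
    (hz0 : z ≠ 0) {v : ℂ}
    (hv : ∀ a : Circle, ((v - extremalH β a lam z) / supportNormal lam z a).re ≤ 0) :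
    v ∈ convexHull ℝ (range fun a : Circle => extremalH β a lam z) := by
  by_contra hmem
  have hK : IsCompact (convexHull ℝ (range fun a : Circle => extremalH β a lam z)) :=
    isCompact_convexHull_of_isCompact (isCompact_range (continuous_extremalH β hlam hz))
  obtain ⟨ℓ, u, h1, h2⟩ :=
    geometric_hahn_banach_closed_point (convex_convexHull ℝ _) hK.isClosed hmem
  set c : ℂ := ⟨ℓ 1, ℓ I⟩ with hc
  have hℓ (w : ℂ) : ℓ w = (w * conj c).re := by
    conv_lhs => rw [← re_add_im w, ← mul_one (w.re : ℂ), ← real_smul, ← real_smul, map_add,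
      map_smul, map_smul]
    simp [hc]
  have hγ (a : Circle) : ℓ (extremalH β a lam z) < ℓ v :=
    (h1 _ (subset_convexHull ℝ _ (mem_range_self a))).trans h2
  have hc0 : c ≠ 0 := by
    intro h0
    have := hγ 1
    simp [hℓ, h0] at this
  obtain ⟨a, r, hr, hN⟩ := exists_supportNormal_eq hlam hz hz0 c hc0
  have h3 := hv a
  rw [hN, re_div_eq] at h3
  have h4 : 0 < normSq (r * c) :=
    normSq_pos.2 (mul_ne_zero (by exact_mod_cast hr.ne') hc0)
  have h5 : ((v - extremalH β a lam z) * conj (r * c)).re =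
      r * (ℓ v - ℓ (extremalH β a lam z)) := by
    rw [← map_sub, hℓ, ← re_ofReal_mul, map_mul, conj_ofReal]
    congr 1
    ring
  rw [h5] at h3
  exact absurd h3 (not_le.2 (div_pos (mul_pos hr (sub_pos.2 (hγ a))) h4))

theorem variabilityRegion_eq_convexHull (hβ : β < 1) (hlam : ‖lam‖ < 1)
    (hz : z ∈ ball (0 : ℂ) 1) (hz0 : z ≠ 0) :
    variabilityRegion β z lam = convexHull ℝ (range fun a : Circle => extremalH β a lam z) := by
  refine Subset.antisymm (fun v hv => ?_) (convexHull_min ?_ (convex_variabilityRegion β z lam))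
  · refine mem_convexHull_of_re_nonpos hlam hz hz0 fun a => ?_
    rcases eq_extremalH_or_re_neg hβ hlam hz hz0 hv a with h | h
    · simp [h]
    · exact h.le
  · rintro _ ⟨a, rfl⟩
    exact extremalH_mem_variabilityRegion hβ hlam a

theorem frontier_variabilityRegion (hβ : β < 1) (hlam : ‖lam‖ < 1)
    (hz : z ∈ ball (0 : ℂ) 1) (hz0 : z ≠ 0) :
    frontier (variabilityRegion β z lam) = range fun a : Circle => extremalH β a lam z := by
  have hγc := continuous_extremalH β hlam hz
  have hNc := continuous_supportNormal hlam hz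
  have hN0 (a : Circle) := supportNormal_ne_zero hlam a.norm_coe hz hz0
  have hclosed : IsClosed (variabilityRegion β z lam) := by
    rw [variabilityRegion_eq_convexHull hβ hlam hz hz0]
    exact (isCompact_convexHull_of_isCompact (isCompact_range hγc)).isClosed
  rw [hclosed.frontier_eq]
  apply Subset.antisymm
  · rintro v ⟨hv, hvi⟩
    by_contra hγ
    refine hvi (mem_interior_iff_mem_nhds.2 ?_)
    have hD : Continuous fun p : ℂ × Circle =>
        ((p.1 - extremalH β p.2 lam z) / supportNormal lam z p.2).re :=
      continuous_re.comp ((continuous_fst.sub (hγc.comp continuous_snd)).div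
        (hNc.comp continuous_snd) fun p => hN0 p.2)
    -- By compactness of the circle, one neighbourhood of `v` preserves all the strict inequalities
    -- at once.
    have hev := isCompact_univ.eventually_forall_of_forall_eventually (x₀ := v) (K := univ)
      (P := fun v (a : Circle) => ((v - extremalH β a lam z) / supportNormal lam z a).re < 0)
      fun a _ => hD.continuousAt.eventually_lt continuousAt_const
        ((eq_extremalH_or_re_neg hβ hlam hz hz0 hv a).resolve_left
          fun h => hγ ⟨a, h.symm⟩)
    filter_upwards [hev] with w hw
    rw [variabilityRegion_eq_convexHull hβ hlam hz hz0]
    exact mem_convexHull_of_re_nonpos hlam hz hz0 fun a => (hw a (mem_univ a)).le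
  · rintro _ ⟨a, rfl⟩
    refine ⟨extremalH_mem_variabilityRegion hβ hlam a, fun hi => ?_⟩
    -- A small step along the outward normal leaves the region.
    have hcont : Tendsto (fun ε : ℝ => extremalH β a lam z + ε * supportNormal lam z a)
        (𝓝[>] 0) (𝓝 (extremalH β a lam z)) := by
      have : Continuous fun ε : ℝ => extremalH β a lam z + ε * supportNormal lam z a := by
        fun_prop
      simpa using (this.tendsto 0).mono_left nhdsWithin_le_nhds
    obtain ⟨ε, hε, hε0⟩ := ((hcont.eventually (mem_interior_iff_mem_nhds.1 hi)).and
      self_mem_nhdsWithin).exists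
    have hε0 : 0 < ε := hε0
    rcases eq_extremalH_or_re_neg hβ hlam hz hz0 hε a with h | h
    · have h' := add_eq_left.1 h
      exact (mul_ne_zero (ofReal_ne_zero.2 hε0.ne') (hN0 a)) h'
    · rw [add_sub_cancel_left, mul_div_cancel_right₀ _ (hN0 a), ofReal_re] at h
      exact h.not_gt hε0

end RegionOfVariability

theorem corollary6p1 (β : ℝ) (hβ : β < 1) (lam z₀ : ℂ)
    (hlam : lam ∈ Metric.ball (0 : ℂ) 1) (hz₀ : z₀ ∈ Metric.ball (0 : ℂ) 1) (hz₀_ne : z₀ ≠ 0) :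
    RegionOfVariability.IsJordanCurve
        (fun θ : ℝ =>
          RegionOfVariability.extremalH β (Complex.exp ((θ : ℂ) * Complex.I)) lam z₀) ∧
      frontier (RegionOfVariability.variabilityRegion β z₀ lam) =
        (fun θ : ℝ =>
          RegionOfVariability.extremalH β (Complex.exp ((θ : ℂ) * Complex.I)) lam z₀) ''
          Set.Ioc (-Real.pi) Real.pi ∧
      ∀ θ ∈ Set.Ioc (-Real.pi) Real.pi,
        RegionOfVariability.extremalH β (Complex.exp ((θ : ℂ) * Complex.I)) lam ∈
            RegionOfVariability.classR β lam ∧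
          ∀ f ∈ RegionOfVariability.classR β lam,
            f z₀ =
              RegionOfVariability.extremalH β (Complex.exp ((θ : ℂ) * Complex.I)) lam z₀ →
            Set.EqOn f
              (RegionOfVariability.extremalH β (Complex.exp ((θ : ℂ) * Complex.I)) lam)
              (Metric.ball 0 1) := by
  have hlam' : ‖lam‖ < 1 := mem_ball_zero_iff.1 hlam
  have huniq : ∀ a : Circle, ∀ f ∈ RegionOfVariability.classR β lam,
      f z₀ = RegionOfVariability.extremalH β a lam z₀ →
      EqOn f (RegionOfVariability.extremalH β a lam) (ball 0 1) := by
    intro a f hf hfz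
    refine (RegionOfVariability.eqOn_or_re_sub_extremalH_div_neg hβ hlam' a.norm_coe hf hz₀
      hz₀_ne).resolve_right ?_
    simp [hfz]
  have hmem : ∀ a : Circle,
      RegionOfVariability.extremalH β a lam ∈ RegionOfVariability.classR β lam :=
    fun a => RegionOfVariability.extremalH_mem_classR hβ hlam' a.norm_coe.le
  -- A coincidence of values at `z₀` forces equality of the extremal functions by uniqueness, hence
  -- of their parameters.
  have hinj : Function.Injective
      fun a : Circle => RegionOfVariability.extremalH β a lam z₀ := fun a b hab =>
    Circle.ext (RegionOfVariability.eq_of_eqOn_extremalH hβ hlam' a.norm_coe.le b.norm_coe.le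
      (huniq b _ (hmem a) hab))
  simp only [← Circle.coe_exp]
  refine ⟨⟨?_, ?_, ?_⟩, ?_, fun θ _ => ⟨hmem _, huniq _⟩⟩
  · exact ((RegionOfVariability.continuous_extremalH β hlam' hz₀).comp
      Circle.exp.continuous).continuousOn
  · have h : Circle.exp (-Real.pi) = Circle.exp Real.pi := by
      rw [← Circle.exp_add_two_pi]
      congr 1
      ring
    simp only [h]
  · exact hinj.comp_injOn (Circle.exp_injOn_Ioc (by linarith))
  · rw [RegionOfVariability.frontier_variabilityRegion hβ hlam' hz₀ hz₀_ne]
    apply Subset.antisymm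
    · rintro _ ⟨a, rfl⟩
      obtain ⟨θ, hθ, rfl⟩ := Circle.surjOn_exp_neg_pi_pi (mem_univ a)
      exact ⟨θ, hθ, rfl⟩
    · rintro _ ⟨θ, -, rfl⟩
      exact mem_range_self (Circle.exp θ)
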